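/- All normal spaces are assumed Hausdorff. A space is \emph{realcompact} if it is homeomorphic to a closed subspace of some power $\mathbb{R}^{\alpha}$. For a normal space $X$ let $\mathscr{R}_X$ be the ideal of subsets of $X$ generated by all $R\subseteq X$ whose closure $\mathrm{cl}_X R$ is realcompact (the intersection of all non-empty families of subsets of $X$ that contain all such $R$ and are closed under taking subsets and finite unions). A normal space $X$ is \emph{connected modulo realcompactness} if there is no continuous $f:X\to[0,1]$ such that $f^{-1}(0)\notin\mathscr{R}_X$, $f^{-1}(1)\notin\mathscr{R}_X$ and $X\setminus(f^{-1}(0)\cup f^{-1}(1))\in\mathscr{R}_X$. For a completely regular Hausdorff space $X$ let $\beta X$ be its Stone--\v{C}ech compactification and $\upsilon X\subseteq\beta X$ its Hewitt realcompactification. \textbf{Theorem.} Let $X$ be a normal space, $Y$ a topological space and $\phi:X\to Y$ a perfect open continuous surjection (perfect: closed, with compact fibres). If $X$ is connected modulo realcompactness, then $Y$ is normal and connected modulo realcompactness. Moreover, the continuous extension $\phi_\beta:\beta X\to\beta Y$ of $\phi$ satisfies \[\phi_\beta\big(\mathrm{cl}_{\beta X}(\upsilon X\setminus X)\big)=\mathrm{cl}_{\beta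 Y}(\upsilon Y\setminus Y).\] -/

import Mathlib

open Set Filter Topology

universe u

/-- A space is realcompact if it is homeomorphic to a closed subspace of some power of `ℝ`.
Exponents in the universe of `X` suffice, see `isRealcompact_of_isClosedEmbedding`. -/
def IsRealcompact (X : Type u) [TopologicalSpace X] : Prop :=
  ∃ (ι : Type u) (e : X → ι → ℝ), IsClosedEmbedding e

theorem isRealcompact_of_isClosedEmbedding {X ι : Type*} [TopologicalSpace X] {e : X → ι → ℝ}
    (he : IsClosedEmbedding e) : IsRealcompact X := by
  let c : ι → C(X, ℝ) := fun i => ⟨fun x => e x i, (continuous_apply i).comp he.continuous⟩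
  let E : X → C(X, ℝ) → ℝ := fun x f => f x
  let P : (C(X, ℝ) → ℝ) → ι → ℝ := fun g i => g (c i)
  have hE : Continuous E := continuous_pi fun f => f.continuous
  have hP : Continuous P := continuous_pi fun i => continuous_apply (c i)
  refine ⟨C(X, ℝ), E, .of_continuous_injective_isClosedMap hE (fun x y h => ?_) ?_⟩
  · exact he.injective (congrArg P h)
  · exact (isProperMap_of_comp_of_t2 hE hP (show IsProperMap (P ∘ E) from
      he.isProperMap)).isClosedMap

/-- The ideal of subsets of `X` generated by a family `𝒜`: the intersection of all ideals of
subsets of `X` that contain `𝒜`. -/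
def idealGeneratedBy {X : Type*} (𝒜 : Set (Set X)) : Order.Ideal (Set X) :=
  sInf {I : Order.Ideal (Set X) | ∀ A ∈ 𝒜, A ∈ I}

/-- `f : X → [0,1]` is 2-valued modulo the ideal `H`. -/
def IsTwoValuedModulo {X : Type*} (H : Order.Ideal (Set X)) (f : X → unitInterval) : Prop :=
  f ⁻¹' {0} ∉ H ∧ f ⁻¹' {1} ∉ H ∧ (f ⁻¹' {0} ∪ f ⁻¹' {1})ᶜ ∈ H

/-- `X` is connected modulo the ideal `H`. -/
def IsConnectedModulo (X : Type*) [TopologicalSpace X] (H : Order.Ideal (Set X)) : Prop :=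
  ¬ ∃ f : X → unitInterval, Continuous f ∧ IsTwoValuedModulo H f

/-- The ideal of `X` generated by the subsets whose closure (as a subspace) is realcompact. -/
def realcompactIdeal (X : Type*) [TopologicalSpace X] : Order.Ideal (Set X) :=
  idealGeneratedBy {R : Set X | IsRealcompact (closure R)}

/-- `X` is connected modulo realcompactness: it is a normal (Hausdorff) space that is connected
modulo the ideal generated by the subsets with realcompact closure. -/
def IsConnectedModuloRealcompactness (X : Type*) [TopologicalSpace X] : Prop :=
  T4Space X ∧ IsConnectedModulo X (realcompactIdeal X)

/-- The Hewitt realcompactification `υX` as a subspace of `βX`: the points `p` of `βX` such that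
every continuous `f : X → ℝ` has a (finite) limit at `p`, that is, extends continuously to
`X ∪ {p}`. That it is a realcompactification of `X` to which all continuous real functions on `X`
extend is proved in `hewitt_spec`. -/
def hewitt (X : Type*) [TopologicalSpace X] : Set (StoneCech X) :=
  {p | ∀ f : X → ℝ, Continuous f → ∃ r : ℝ, Tendsto f (comap stoneCechUnit (𝓝 p)) (𝓝 r)}

/-- The extension `φ_β : βX → βY` of a continuous map `φ : X → Y`. -/
noncomputable def betaMap {X Y : Type*} [TopologicalSpace X] [TopologicalSpace Y] (φ : X → Y)
    (hφ : Continuous φ) : StoneCech X → StoneCech Y :=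
  stoneCechExtend (continuous_stoneCechUnit.comp hφ)

theorem stoneCechUnit_mem_hewitt {X : Type*} [TopologicalSpace X] [T35Space X] (x : X) :
    stoneCechUnit x ∈ hewitt X := by
  intro f hf
  refine ⟨f x, ?_⟩
  rw [← (isDenseEmbedding_stoneCechUnit (X := X)).isInducing.nhds_eq_comap]
  exact hf.continuousAt

/-- `hewitt X` contains `X`, which is dense in it, it is realcompact, and every continuous real
function on `X` extends continuously to it. -/
theorem hewitt_spec (X : Type*) [TopologicalSpace X] [T35Space X] :
    range (stoneCechUnit : X → StoneCech X) ⊆ hewitt X ∧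
    hewitt X ⊆ closure (range (stoneCechUnit : X → StoneCech X)) ∧
    IsRealcompact (hewitt X) ∧
    ∀ f : X → ℝ, Continuous f → ∃ F : hewitt X → ℝ, Continuous F ∧
      ∀ x, F ⟨stoneCechUnit x, stoneCechUnit_mem_hewitt x⟩ = f x := by
  have hD := isDenseEmbedding_stoneCechUnit (X := X)
  let i : X → hewitt X := fun x => ⟨stoneCechUnit x, stoneCechUnit_mem_hewitt x⟩
  have hi_ind : IsInducing i :=
    IsInducing.of_comp (continuous_stoneCechUnit.subtype_mk _) continuous_subtype_val
      hD.isInducing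
  have hi : IsDenseInducing i := by
    refine ⟨hi_ind, fun p => ?_⟩
    rw [closure_subtype]
    have : (Subtype.val '' range i) = range (stoneCechUnit : X → StoneCech X) := by
      rw [← range_comp]; rfl
    rw [this]
    exact hD.dense _
  have hcomap : ∀ p : hewitt X, comap i (𝓝 p) = comap stoneCechUnit (𝓝 (p : StoneCech X)) := by
    intro p
    rw [nhds_subtype_eq_comap, comap_comap]; rfl
  have hext : ∀ f : X → ℝ, Continuous f →
      ∃ F : hewitt X → ℝ, Continuous F ∧ ∀ x, F (i x) = f x := by
    intro f hf
    refine ⟨hi.extend f, hi.continuous_extend fun p => ?_, fun x => hi.extend_eq hf x⟩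
    rw [hcomap]; exact p.2 f hf
  refine ⟨?_, fun p _ => hD.dense p, ?_, hext⟩
  · rintro _ ⟨x, rfl⟩; exact stoneCechUnit_mem_hewitt x
  choose F hFc hFi using fun f : C(X, ℝ) => hext f f.continuous
  refine ⟨C(X, ℝ), fun p f => F f p, ?_⟩
  have hcont : Continuous (fun (p : hewitt X) (f : C(X, ℝ)) => F f p) :=
    continuous_pi fun f => hFc f
  refine .of_continuous_injective_isClosedMap hcont ?_ (IsProperMap.isClosedMap ?_)
  · intro p q hpq
    by_contra hne
    have hne' : (p : StoneCech X) ≠ q := fun h => hne (Subtype.ext h)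
    obtain ⟨g, hg, h0, h1⟩ := CompletelyRegularSpace.completely_regular (p : StoneCech X) {↑q}
      isClosed_singleton (by simpa using hne')
    let g' : C(X, ℝ) := ⟨fun x => (g (stoneCechUnit x) : ℝ), (continuous_subtype_val.comp hg).comp continuous_stoneCechUnit⟩
    have hg' : F g' = fun p : hewitt X => (g (p : StoneCech X) : ℝ) :=
      hi.dense.equalizer (hFc g') (by fun_prop) (funext fun x => hFi g' x)
    have := congrFun hpq g'
    simp only [hg', h0, h1 (mem_singleton _)] at this
    simp at this
  · rw [isProperMap_iff_ultrafilter]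
    refine ⟨hcont, fun U r hU => ?_⟩
    obtain ⟨p, hp⟩ : ∃ p : StoneCech X, Tendsto Subtype.val (U : Filter (hewitt X)) (𝓝 p) := by
      obtain ⟨p, -, hp⟩ := isCompact_univ.ultrafilter_le_nhds (U.map Subtype.val) (by simp)
      exact ⟨p, hp⟩
    have hlim : ∀ f : C(X, ℝ), Tendsto f (comap stoneCechUnit (𝓝 p)) (𝓝 (r f)) := by
      intro f
      have hUf : Tendsto (F f) U (𝓝 (r f)) := (tendsto_pi_nhds.1 hU) f
      let t : ℝ → Icc (r f - 1) (r f + 1) := projIcc _ _ (by linarith)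
      have ht : Continuous t := continuous_projIcc
      let G := stoneCechExtend (ht.comp f.continuous)
      have hG : Continuous G := continuous_stoneCechExtend _
      have hGi : ∀ x, G (stoneCechUnit x) = t (f x) := fun x =>
        congrFun (stoneCechExtend_extends (ht.comp f.continuous)) x
      have hGF : (fun p : hewitt X => G p) = fun p => t (F f p) :=
        hi.dense.equalizer (by fun_prop) (ht.comp (hFc f))
          (funext fun x => (hGi x).trans (by simp [hFi]))
      have hGp : G p = t (r f) := by
        refine tendsto_nhds_unique (f := fun p : hewitt X => G p) (l := U)
          ((hG.tendsto p).comp hp) ?_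
        rw [hGF]
        exact (ht.tendsto _).comp hUf
      have htr : (t (r f) : ℝ) = r f := by
        rw [show t (r f) = ⟨r f, by constructor <;> linarith⟩ from
          projIcc_of_mem _ (by constructor <;> linarith)]
      have hT : Tendsto (fun x => (t (f x) : ℝ)) (comap stoneCechUnit (𝓝 p)) (𝓝 (r f)) := by
        have h1 : Tendsto (fun q => (G q : ℝ)) (𝓝 p) (𝓝 (r f)) := by
          have := (continuous_subtype_val.comp hG).tendsto p
          simpa [Function.comp_def, hGp, htr] using this
        refine (h1.comp tendsto_comap).congr fun x => ?_
        simp [hGi]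
      refine hT.congr' ?_
      filter_upwards [hT.eventually (Ioo_mem_nhds (sub_one_lt (r f)) (lt_add_one (r f)))]
        with x hx
      have h2 : (t (f x) : ℝ) = max (r f - 1) (min (r f + 1) (f x)) := coe_projIcc ..
      rw [h2] at hx ⊢
      obtain ⟨ha, hb⟩ := hx
      grind
    have hpm : p ∈ hewitt X := fun f hf => ⟨r ⟨f, hf⟩, hlim ⟨f, hf⟩⟩
    refine ⟨⟨p, hpm⟩, funext fun f => ?_, ?_⟩
    · have hne : NeBot (comap i (𝓝 ⟨p, hpm⟩)) := hi.comap_nhds_neBot _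
      refine tendsto_nhds_unique (f := f) (l := comap i (𝓝 ⟨p, hpm⟩)) ?_ ?_
      · refine (((hFc f).tendsto ⟨p, hpm⟩).comp tendsto_comap).congr fun x => hFi f x
      · rw [hcomap]; exact hlim f
    · rw [nhds_subtype_eq_comap]
      exact tendsto_iff_comap.1 hp

section Hewitt

variable {X : Type*} [TopologicalSpace X]

/-- A subset of a normal space has realcompact closure iff its closure in `βX` meets `υX` only in
points of `X`. -/
theorem isRealcompact_closure_iff [T4Space X] (R : Set X) :
    IsRealcompact (closure R) ↔
      closure (stoneCechUnit '' R) ∩ hewitt X ⊆ range (stoneCechUnit : X → StoneCech X) := by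
  have hD := isDenseEmbedding_stoneCechUnit (X := X)
  constructor
  · rintro ⟨ι, e, he⟩ p ⟨hpR, hp⟩
    let l : Filter (closure R) := comap (fun x => stoneCechUnit (x : X)) (𝓝 p)
    have hl : l.NeBot := by
      refine comap_neBot fun t ht => ?_
      obtain ⟨_, hqt, x, hx, rfl⟩ := mem_closure_iff_nhds.1 hpR t ht
      exact ⟨⟨x, subset_closure hx⟩, hqt⟩
    have hlim : ∀ i, ∃ r : ℝ, Tendsto (fun a => e a i) l (𝓝 r) := by
      intro i
      let h : C(closure R, ℝ) := ⟨fun a => e a i, (continuous_apply i).comp he.continuous⟩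
      obtain ⟨g, hg⟩ := ContinuousMap.exists_restrict_eq isClosed_closure h
      obtain ⟨r, hr⟩ := hp g g.continuous
      refine ⟨r, ?_⟩
      have hval : Tendsto (Subtype.val : closure R → X) l (comap stoneCechUnit (𝓝 p)) :=
        tendsto_comap_iff.2 tendsto_comap
      exact (hr.comp hval).congr fun a => DFunLike.congr_fun hg a
    choose r hr using hlim
    have hr' : Tendsto e l (𝓝 r) := tendsto_pi_nhds.2 hr
    obtain ⟨a, rfl⟩ : r ∈ range e :=
      he.isClosed_range.mem_of_tendsto hr' (Eventually.of_forall fun a => mem_range_self a)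
    have ha : Tendsto id l (𝓝 a) := by
      rw [he.isInducing.tendsto_nhds_iff]; exact hr'
    have ha' : Tendsto (fun x : closure R => stoneCechUnit (x : X)) l
        (𝓝 (stoneCechUnit (a : X))) :=
      ((continuous_stoneCechUnit.comp continuous_subtype_val).tendsto a).comp ha
    exact ⟨a, tendsto_nhds_unique ha' tendsto_comap⟩
  · intro h
    obtain ⟨-, -, ⟨ι, e, he⟩, -⟩ := hewitt_spec X
    let i : closure R → hewitt X := fun x => ⟨stoneCechUnit (x : X), stoneCechUnit_mem_hewitt _⟩
    have hi : IsEmbedding i :=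
      IsEmbedding.of_comp
        ((continuous_stoneCechUnit.comp continuous_subtype_val).subtype_mk _)
        continuous_subtype_val (hD.isEmbedding.comp IsEmbedding.subtypeVal)
    have hrange : range i = Subtype.val ⁻¹' closure (stoneCechUnit '' R) := by
      ext ⟨p, hp⟩
      constructor
      · rintro ⟨⟨x, hx⟩, hxp⟩
        have hxp : stoneCechUnit x = p := congrArg Subtype.val hxp
        subst hxp
        exact image_closure_subset_closure_image continuous_stoneCechUnit (mem_image_of_mem _ hx)
      · intro hpR
        obtain ⟨x, rfl⟩ := h ⟨hpR, hp⟩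
        refine ⟨⟨x, ?_⟩, rfl⟩
        rw [hD.isInducing.closure_eq_preimage_closure_image]
        exact hpR
    refine isRealcompact_of_isClosedEmbedding (he.comp ⟨hi, ?_⟩)
    rw [hrange]
    exact isClosed_closure.preimage continuous_subtype_val

theorem mem_realcompactIdeal_iff [T4Space X] (R : Set X) :
    R ∈ realcompactIdeal X ↔
      closure (stoneCechUnit '' R) ∩ hewitt X ⊆ range (stoneCechUnit : X → StoneCech X) := by
  let J : Order.Ideal (Set X) :=
    { carrier := {R | closure (stoneCechUnit '' R) ∩ hewitt X ⊆
        range (stoneCechUnit : X → StoneCech X)}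
      lower' := fun A B hBA hA =>
        (inter_subset_inter_left _ (closure_mono (image_mono hBA))).trans hA
      nonempty' := ⟨∅, by simp⟩
      directed' := fun A hA B hB => by
        refine ⟨A ∪ B, ?_, subset_union_left, subset_union_right⟩
        rw [mem_ofPred_eq, image_union, closure_union, union_inter_distrib_right]
        exact union_subset hA hB }
  rw [realcompactIdeal, idealGeneratedBy, Order.Ideal.mem_sInf]
  constructor
  · intro h
    exact h (s := J) fun A hA => (isRealcompact_closure_iff A).1 hA
  · intro h I hI
    exact hI R ((isRealcompact_closure_iff R).2 h)

instance comap_stoneCechUnit_nhds_neBot (p : StoneCech X) :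
    (comap stoneCechUnit (𝓝 p) : Filter X).NeBot :=
  comap_neBot fun _ ht =>
    let ⟨_, hqt, x, hx⟩ := mem_closure_iff_nhds.1 (denseRange_stoneCechUnit p) _ ht
    ⟨x, hx ▸ hqt⟩

/-- A continuous real function that is bounded near a point of `βX` has a limit there. -/
theorem exists_tendsto_of_eventually_abs_le {p : StoneCech X} {f : X → ℝ} (hf : Continuous f)
    {M : ℝ} (hM : ∀ᶠ x in comap stoneCechUnit (𝓝 p), |f x| ≤ M) :
    ∃ r : ℝ, Tendsto f (comap stoneCechUnit (𝓝 p)) (𝓝 r) := by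
  have hle : -|M| ≤ |M| := by linarith [abs_nonneg M]
  let g : X → Icc (-|M|) |M| := projIcc _ _ hle ∘ f
  have ht : Continuous g := continuous_projIcc.comp hf
  refine ⟨(stoneCechExtend ht p : Icc (-|M|) |M|), ?_⟩
  have hT := ((continuous_subtype_val.comp (continuous_stoneCechExtend ht)).tendsto p).comp
    (tendsto_comap (f := stoneCechUnit))
  refine hT.congr' ?_
  filter_upwards [hM] with x hx
  have hmem : f x ∈ Icc (-|M|) |M| := abs_le.1 (hx.trans (le_abs_self M))
  have hext := congrFun (stoneCechExtend_extends ht) x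
  simp only [Function.comp_apply] at hext ⊢
  rw [hext]
  exact congrArg Subtype.val (projIcc_of_mem hle hmem)

end Hewitt

section PerfectMaps

variable {X Y : Type*} [TopologicalSpace X] [TopologicalSpace Y] {φ : X → Y}

theorem IsClosedMap.t4Space_of_surjective [T4Space X] (hφ : IsClosedMap φ) (hc : Continuous φ)
    (hsurj : Function.Surjective φ) : T4Space Y := by
  have : T1Space Y := ⟨fun y => by
    obtain ⟨x, rfl⟩ := hsurj y
    simpa using hφ {x} isClosed_singleton⟩
  have : NormalSpace Y := ⟨fun A B hA hB hAB => by
    obtain ⟨U, V, hU, hV, hAU, hBV, hUV⟩ :=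
      normal_separation (hA.preimage hc) (hB.preimage hc) (hAB.preimage φ)
    refine ⟨(φ '' Uᶜ)ᶜ, (φ '' Vᶜ)ᶜ, (hφ _ hU.isClosed_compl).isOpen_compl,
      (hφ _ hV.isClosed_compl).isOpen_compl, ?_, ?_, ?_⟩
    · rintro _ hy ⟨x, hx, rfl⟩
      exact hx (hAU hy)
    · rintro _ hy ⟨x, hx, rfl⟩
      exact hx (hBV hy)
    · rw [disjoint_left]
      intro y hyU hyV
      obtain ⟨x, rfl⟩ := hsurj y
      exact disjoint_left.1 hUV (not_not.1 fun h => hyU ⟨x, h, rfl⟩)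
        (not_not.1 fun h => hyV ⟨x, h, rfl⟩)⟩
  exact {}

/-- Fibrewise suprema of a continuous function along an open perfect surjection are continuous. -/
theorem IsProperMap.continuous_sSup_image_fiber (hφ : IsProperMap φ) (hopen : IsOpenMap φ)
    (hsurj : Function.Surjective φ) [T1Space Y] {f : X → ℝ} (hf : Continuous f) :
    Continuous fun y => sSup (f '' (φ ⁻¹' {y})) := by
  have hcpt : ∀ y, IsCompact (f '' (φ ⁻¹' {y})) := fun y =>
    (hφ.isCompact_preimage isCompact_singleton).image hf
  have hne : ∀ y, (f '' (φ ⁻¹' {y})).Nonempty := fun y => by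
    obtain ⟨x, hx⟩ := hsurj y
    exact ⟨f x, x, hx, rfl⟩
  rw [continuous_iff_lower_upperSemicontinuous]
  constructor
  · rw [lowerSemicontinuous_iff_isOpen_preimage]
    intro a
    convert hopen _ (isOpen_Ioi.preimage hf : IsOpen (f ⁻¹' Ioi a)) using 1
    ext y
    simp only [mem_preimage, mem_Ioi, lt_csSup_iff (hcpt y).bddAbove (hne y), mem_image,
      mem_singleton_iff, exists_exists_and_eq_and]
    exact exists_congr fun x => and_comm
  · rw [upperSemicontinuous_iff_isOpen_preimage]
    intro a
    convert (hφ.isClosedMap _ (isClosed_Ici.preimage hf : IsClosed (f ⁻¹' Ici a))).isOpen_compl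
      using 1
    ext y
    simp only [mem_preimage, mem_Iio, mem_compl_iff, mem_image, mem_Ici, not_exists, not_and]
    rw [(hφ.isCompact_preimage isCompact_singleton).sSup_lt_iff_of_continuous (hsurj y)
      hf.continuousOn]
    exact forall_congr' fun x => by rw [← not_le]; exact imp_not_comm

theorem betaMap_stoneCechUnit (hφ : Continuous φ) (x : X) :
    betaMap φ hφ (stoneCechUnit x) = stoneCechUnit (φ x) :=
  congrFun (stoneCechExtend_extends (continuous_stoneCechUnit.comp hφ)) x

theorem continuous_betaMap (hφ : Continuous φ) : Continuous (betaMap φ hφ) :=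
  continuous_stoneCechExtend _

theorem betaMap_surjective (hφ : Continuous φ) (hsurj : Function.Surjective φ) :
    Function.Surjective (betaMap φ hφ) := by
  rw [← range_eq_univ, ← (continuous_betaMap hφ).isClosedMap.isClosed_range.closure_eq,
    ← univ_subset_iff, ← (denseRange_stoneCechUnit (α := Y)).closure_range]
  refine closure_mono ?_
  rintro _ ⟨y, rfl⟩
  obtain ⟨x, rfl⟩ := hsurj y
  exact ⟨_, betaMap_stoneCechUnit hφ x⟩

theorem tendsto_comap_stoneCechUnit (hφ : Continuous φ) (p : StoneCech X) :
    Tendsto φ (comap stoneCechUnit (𝓝 p)) (comap stoneCechUnit (𝓝 (betaMap φ hφ p))) := by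
  rw [tendsto_comap_iff]
  refine (((continuous_betaMap hφ).tendsto p).comp tendsto_comap).congr fun x => ?_
  exact betaMap_stoneCechUnit hφ x

theorem betaMap_image_closure (hφ : Continuous φ) (S : Set (StoneCech X)) :
    betaMap φ hφ '' closure S = closure (betaMap φ hφ '' S) :=
  ((continuous_betaMap hφ).isClosedMap.closure_image_eq_of_continuous
    (continuous_betaMap hφ) S).symm

theorem IsProperMap.betaMap_preimage_range [T35Space Y] (hφ : IsProperMap φ) :
    betaMap φ hφ.continuous ⁻¹' range stoneCechUnit = range stoneCechUnit := by
  apply Subset.antisymm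
  · rintro p ⟨y, hy⟩
    have hT := tendsto_comap_stoneCechUnit hφ.continuous p
    rw [← hy, ← (isDenseEmbedding_stoneCechUnit (X := Y)).isInducing.nhds_eq_comap] at hT
    have hcl : MapClusterPt y (comap stoneCechUnit (𝓝 p)) φ := hT.mapClusterPt
    obtain ⟨x, -, hx⟩ := hφ.clusterPt_of_mapClusterPt hcl
    refine ⟨x, ?_⟩
    have hc : ClusterPt (stoneCechUnit x) (𝓝 p) :=
      hx.map continuous_stoneCechUnit.continuousAt tendsto_comap
    have : (𝓝 (stoneCechUnit x) ⊓ 𝓝 p).NeBot := hc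
    exact eq_of_nhds_neBot this
  · rintro _ ⟨x, rfl⟩
    exact ⟨φ x, (betaMap_stoneCechUnit hφ.continuous x).symm⟩

theorem IsProperMap.betaMap_preimage_hewitt [T1Space Y] (hφ : IsProperMap φ)
    (hopen : IsOpenMap φ) (hsurj : Function.Surjective φ) :
    betaMap φ hφ.continuous ⁻¹' hewitt Y = hewitt X := by
  ext p
  have hT := tendsto_comap_stoneCechUnit hφ.continuous p
  constructor
  · intro hp f hf
    obtain ⟨r, hr⟩ := hp _ (hφ.continuous_sSup_image_fiber hopen hsurj hf.abs)
    refine exists_tendsto_of_eventually_abs_le hf (M := r + 1) ?_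
    filter_upwards [(hr.comp hT).eventually (Iio_mem_nhds (lt_add_one r))] with x hx
    refine le_trans (le_csSup ?_ (mem_image_of_mem (fun x => |f x|) (rfl : x ∈ φ ⁻¹' {φ x})))
      (le_of_lt hx)
    exact ((hφ.isCompact_preimage isCompact_singleton).image hf.abs).bddAbove
  · intro hp g hg
    obtain ⟨r, hr⟩ := hp _ (hg.comp hφ.continuous)
    have hb : Continuous fun y => min |g y| (|r| + 1) := hg.abs.min continuous_const
    have hle : ∀ y, |min |g y| (|r| + 1)| ≤ |r| + 1 := fun y => by
      rw [abs_of_nonneg (le_min (abs_nonneg _) (by positivity))]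
      exact min_le_right _ _
    obtain ⟨s, hs⟩ := exists_tendsto_of_eventually_abs_le (p := betaMap φ hφ.continuous p) hb
      (Eventually.of_forall hle)
    have hsr : s = min |r| (|r| + 1) :=
      tendsto_nhds_unique (hs.comp hT) (hr.abs.min tendsto_const_nhds)
    rw [min_eq_left (by linarith)] at hsr
    subst hsr
    refine exists_tendsto_of_eventually_abs_le hg (M := |r| + 1) ?_
    filter_upwards [hs.eventually (Iio_mem_nhds (lt_add_one _))] with y hy
    exact ((min_lt_iff.1 hy).resolve_right (lt_irrefl _)).le

theorem IsProperMap.preimage_mem_realcompactIdeal_iff [T4Space X] [T4Space Y]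
    (hφ : IsProperMap φ) (hopen : IsOpenMap φ) (hsurj : Function.Surjective φ) (S : Set Y) :
    φ ⁻¹' S ∈ realcompactIdeal X ↔ S ∈ realcompactIdeal Y := by
  have himg : betaMap φ hφ.continuous '' closure (stoneCechUnit '' (φ ⁻¹' S)) =
      closure (stoneCechUnit '' S) := by
    rw [betaMap_image_closure, image_image]
    simp only [betaMap_stoneCechUnit]
    rw [← image_image stoneCechUnit φ, image_preimage_eq S hsurj]
  rw [mem_realcompactIdeal_iff, mem_realcompactIdeal_iff, ← himg,
    ← hφ.betaMap_preimage_hewitt hopen hsurj, ← hφ.betaMap_preimage_range,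
    ← image_inter_preimage, image_subset_iff]

end PerfectMaps

theorem mainTheorem4 {X Y : Type*} [TopologicalSpace X] [TopologicalSpace Y] [T4Space X]
    (φ : X → Y) (hφ : IsProperMap φ) (hopen : IsOpenMap φ) (hsurj : Function.Surjective φ) :
    (IsConnectedModuloRealcompactness X → IsConnectedModuloRealcompactness Y) ∧
    betaMap φ hφ.continuous ''
        closure (hewitt X \ range (stoneCechUnit : X → StoneCech X)) =
      closure (hewitt Y \ range (stoneCechUnit : Y → StoneCech Y)) := by
  have hY : T4Space Y := hφ.isClosedMap.t4Space_of_surjective hφ.continuous hsurj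
  refine ⟨fun hX => ⟨hY, ?_⟩, ?_⟩
  · rintro ⟨g, hg, h0, h1, h01⟩
    refine hX.2 ⟨g ∘ φ, hg.comp hφ.continuous, ?_, ?_, ?_⟩
    · rwa [preimage_comp, hφ.preimage_mem_realcompactIdeal_iff hopen hsurj]
    · rwa [preimage_comp, hφ.preimage_mem_realcompactIdeal_iff hopen hsurj]
    · rwa [preimage_comp, preimage_comp, ← preimage_union, ← preimage_compl,
        hφ.preimage_mem_realcompactIdeal_iff hopen hsurj]
  · rw [betaMap_image_closure, ← hφ.betaMap_preimage_hewitt hopen hsurj,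
      ← hφ.betaMap_preimage_range, ← preimage_sdiff,
      image_preimage_eq _ (betaMap_surjective hφ.continuous hsurj)]
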